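/- An overpartition of a nonnegative integer $m$ is a partition of $m$ in which, for each part size that occurs, the last appearance of that size is either overlined or not; let $\overline{p}(m)$ denote the number of overpartitions of $m$ (so, for example, $\overline{p}(3) = 8$). For each $(A,B) \in \{(36,30), (72,42), (196,70), (252,114)\}$ and every integer $n \ge 0$, $$\overline{p}(An+B) \equiv 0 \pmod{16}.$$ -/

import Mathlib

/-- An overpartition of `n`: a partition of `n` together with the set of those part sizes whose
last appearance is overlined. -/
structure Overpartition (n : ℕ) where
  /-- the underlying partition -/
  partition : n.Partition
  /-- the part sizes whose last appearance is overlined -/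
  overlined : Finset ℕ
  /-- only sizes that appear as parts can be overlined -/
  overlined_subset : overlined ⊆ partition.parts.toFinset

/-- An overpartition is a partition together with a subset of its set of part sizes. -/
def Overpartition.equivSigma (n : ℕ) :
    Overpartition n ≃ (Σ p : n.Partition, {s : Finset ℕ // s ∈ p.parts.toFinset.powerset}) where
  toFun x := ⟨x.partition, x.overlined, Finset.mem_powerset.2 x.overlined_subset⟩
  invFun y := ⟨y.1, y.2.1, Finset.mem_powerset.1 y.2.2⟩
  left_inv _ := rfl
  right_inv _ := rfl

instance Overpartition.instFintype (n : ℕ) : Fintype (Overpartition n) :=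
  Fintype.ofEquiv _ (Overpartition.equivSigma n).symm

/-- The overpartition function: the number of overpartitions of `n`. -/
def overpartitionCount (n : ℕ) : ℕ := Fintype.card (Overpartition n)

/-!
The generating function of overpartitions is `∏ (1 + X ^ k) / (1 - X ^ k)`, and Gauss's square
identity says that its inverse is `1 + 2 * S` with `S = ∑_{k ≥ 1} (-1) ^ k X ^ (k ^ 2)`. Expanding
`1 / (1 + 2 * S)` modulo `16` leaves `1 - 2 * S + 4 * S ^ 2 - 8 * S ^ 3`
(`overpartitionCount_modEq`).

Each `m` in question is `3 * k` with `3 ∤ k` or `7 * k` with `7 ∤ k`, hence is not a sum of two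
squares, and the coefficients of `S` and `S ^ 2` at `m` vanish. So it remains to see that the
coefficient of `S ^ 3` is even. As `S ^ 2` is congruent to `S(X ^ 2)` modulo `2`, this coefficient
has the parity of the number of pairs of positive integers `(a, c)` with `a ^ 2 + 2 * c ^ 2 = m`
(`coeff_alternatingSquares_cube_cast`). For `m = 196 * n + 70` there are none, because `-2` is not
a square modulo `7`. In the other cases `m = 6 * M` with `M` odd, prime to `3` and not a square;
halving `a` leads to `x ^ 2 + 2 * y ^ 2 = 3 * M`, whose positive solutions admit an involution
without fixed points: divide `x + y √-2` by its factor `1 ± √-2`, conjugate, and multiply back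
(`reflectPair_spec`).

Gauss's identity is obtained from a finite form with an explicit error term, due to Shanks, which
is proved by a telescoping sum (`one_add_two_mul_sum_sq_mul_prod`).
-/

open Finset PowerSeries

/-! ### A finite form of Gauss's square identity -/

section FiniteGauss

variable {R : Type*} [CommRing R]

/-- The telescoping sum behind the induction step of `one_add_two_mul_sum_sq_mul_prod`: the
product and the first `m` summands on the right there for `n + 1`, minus
`1 + x ^ (n + 1)` times those for `n`. -/
theorem prod_Ico_one_sub_pow_telescope (x : R) (n m : ℕ) (hm : m ≤ n) :
    (∏ k ∈ Ico 0 (n + 1), (1 - x ^ (k + 1)) +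
        2 * ∑ s ∈ range m, (-1) ^ (s + 1) * (∏ k ∈ Ico (s + 1) (n + 1), (1 - x ^ (k + 1))) *
          (∏ k ∈ range s, (1 + x ^ (k + 1))) * x ^ ((s + 1) * (n + 2))) -
      (1 + x ^ (n + 1)) * (∏ k ∈ Ico 0 n, (1 - x ^ (k + 1)) +
        2 * ∑ s ∈ range m, (-1) ^ (s + 1) * (∏ k ∈ Ico (s + 1) n, (1 - x ^ (k + 1))) *
          (∏ k ∈ range s, (1 + x ^ (k + 1))) * x ^ ((s + 1) * (n + 1))) =
      -(2 * (-1) ^ m * (∏ k ∈ Ico m n, (1 - x ^ (k + 1))) *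
        (∏ k ∈ range m, (1 + x ^ (k + 1))) * x ^ ((m + 1) * (n + 1))) := by
  induction m with
  | zero =>
    rw [prod_Ico_succ_top (Nat.zero_le n)]
    simp
    ring
  | succ m ih =>
    have ih := ih (by omega)
    rw [prod_eq_prod_Ico_succ_bot (by omega : m < n)] at ih
    rw [sum_range_succ, sum_range_succ, prod_range_succ,
      prod_Ico_succ_top (by omega : m + 1 ≤ n)]
    have e1 : x ^ ((m + 1) * (n + 2)) = x ^ ((m + 1) * (n + 1)) * x ^ (m + 1) := by ring
    have e2 : x ^ ((m + 1 + 1) * (n + 1)) = x ^ ((m + 1) * (n + 1)) * x ^ (n + 1) := by ring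
    have e3 : (-1 : R) ^ (m + 1) = -(-1) ^ m := by ring
    rw [e1, e2, e3]
    linear_combination ih

/-- Shanks's finite form of Gauss's square identity, with denominators cleared. All terms of the
sum on the right are divisible by `x ^ (n + 1)`. -/
theorem one_add_two_mul_sum_sq_mul_prod (x : R) (n : ℕ) :
    (1 + 2 * ∑ s ∈ range n, (-1) ^ (s + 1) * x ^ ((s + 1) ^ 2)) *
        ∏ k ∈ range n, (1 + x ^ (k + 1)) =
      ∏ k ∈ Ico 0 n, (1 - x ^ (k + 1)) +
        2 * ∑ s ∈ range n, (-1) ^ (s + 1) * (∏ k ∈ Ico (s + 1) n, (1 - x ^ (k + 1))) *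
          (∏ k ∈ range s, (1 + x ^ (k + 1))) * x ^ ((s + 1) * (n + 1)) := by
  induction n with
  | zero => simp
  | succ n ih =>
    have ht := prod_Ico_one_sub_pow_telescope x n n le_rfl
    rw [← ih] at ht
    rw [sum_range_succ, sum_range_succ, prod_range_succ]
    simp only [Ico_self, prod_empty] at ht ⊢
    have e1 : x ^ ((n + 1) * (n + 1 + 1)) = x ^ ((n + 1) ^ 2) * x ^ (n + 1) := by ring
    have e2 : x ^ ((n + 1) * (n + 1)) = x ^ ((n + 1) ^ 2) := by ring
    have e3 : (-1 : R) ^ (n + 1) = -(-1) ^ n := by ring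
    rw [e2] at ht
    rw [e1, e3]
    linear_combination -ht

theorem pow_dvd_one_add_two_mul_sum_sq_mul_prod_sub (x : R) (n : ℕ) :
    x ^ (n + 1) ∣ (1 + 2 * ∑ s ∈ range n, (-1) ^ (s + 1) * x ^ ((s + 1) ^ 2)) *
        ∏ k ∈ range n, (1 + x ^ (k + 1)) - ∏ k ∈ range n, (1 - x ^ (k + 1)) := by
  rw [one_add_two_mul_sum_sq_mul_prod, ← range_eq_Ico, add_sub_cancel_left]
  refine Dvd.dvd.mul_left (dvd_sum fun s _ ↦ Dvd.dvd.mul_left (pow_dvd_pow x ?_) _) _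
  nlinarith

end FiniteGauss

/-! ### The generating function of overpartitions -/

/-- The number of overpartitions is the sum of `2 ^ (number of part sizes)` over partitions, which
is the weight of a partition for the character sending every part size and multiplicity to `2`. -/
theorem mk_overpartitionCount :
    (PowerSeries.mk fun m ↦ (overpartitionCount m : ℤ)) =
      Nat.Partition.genFun fun _ _ ↦ (2 : ℤ) := by
  ext m
  rw [coeff_mk, Nat.Partition.coeff_genFun, overpartitionCount,
    Fintype.card_congr (Overpartition.equivSigma m), Fintype.card_sigma, Nat.cast_sum]
  refine sum_congr rfl fun p _ ↦ ?_
  rw [Fintype.card_coe, card_powerset, Finsupp.prod, prod_const, Multiset.toFinsupp_support]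
  simp

/-- The power series `∑_{k ≥ 1} (-1) ^ k X ^ (k ^ 2)`. Since `k` and `k ^ 2` have the same parity,
the sign can be read off the exponent. -/
noncomputable def alternatingSquares : ℤ⟦X⟧ :=
  PowerSeries.mk fun m ↦ if 0 < m ∧ IsSquare m then (-1) ^ m else 0

theorem coeff_alternatingSquares (m : ℕ) :
    coeff m alternatingSquares = if 0 < m ∧ IsSquare m then (-1) ^ m else 0 :=
  coeff_mk _ _

theorem X_pow_dvd_alternatingSquares_sub (n : ℕ) :
    (X : ℤ⟦X⟧) ^ (n + 1) ∣
      alternatingSquares - ∑ s ∈ range n, (-1) ^ (s + 1) * X ^ ((s + 1) ^ 2) := by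
  rw [X_pow_dvd_iff]
  intro m hm
  have hc (s : ℕ) : coeff m ((-1 : ℤ⟦X⟧) ^ (s + 1) * X ^ ((s + 1) ^ 2)) =
      if m = (s + 1) ^ 2 then (-1) ^ m else 0 := by
    have : ((-1 : ℤ⟦X⟧) ^ (s + 1)) = C ((-1 : ℤ) ^ (s + 1)) := by simp
    rw [this, coeff_C_mul, coeff_X_pow]
    split_ifs with h
    · rw [h, mul_one]
      exact neg_one_pow_congr (by simp [Nat.even_pow])
    · simp
  rw [map_sub, map_sum, coeff_alternatingSquares, sub_eq_zero]
  simp_rw [hc]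
  split_ifs with h
  · obtain ⟨h0, r, rfl⟩ := h
    have hr : 0 < r := Nat.pos_of_mul_pos_left h0
    rw [sum_eq_single (r - 1)]
    · rw [if_pos]
      rw [Nat.sub_add_cancel hr, sq]
    · intro b _ hb
      rw [if_neg]
      intro hrb
      rw [← sq, Nat.pow_left_inj two_ne_zero] at hrb
      omega
    · intro hr'
      rw [mem_range] at hr'
      have := Nat.le_mul_self r
      omega
  · refine (sum_eq_zero fun s _ ↦ if_neg fun hs ↦ h ⟨?_, ?_⟩).symm
    · rw [hs]; positivity
    · exact ⟨s + 1, by rw [hs, sq]⟩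

section Topology

open scoped PowerSeries.WithPiTopology

/-- The Euler factor at `k = i + 1` is `(1 + X ^ k) / (1 - X ^ k)`. -/
theorem one_add_tsum_mul_one_sub (i : ℕ) :
    (1 + ∑' j, 2 * (X : ℤ⟦X⟧) ^ ((i + 1) * (j + 1))) * (1 - X ^ (i + 1)) =
      1 + X ^ (i + 1) := by
  have hs : Summable fun j ↦ 2 * (X : ℤ⟦X⟧) ^ ((i + 1) * (j + 1)) := by
    simpa only [smul_eq_C_mul, map_ofNat] using
      Nat.Partition.summable_genFun_term (fun _ _ ↦ (2 : ℤ)) i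
  have h0 := hs.tsum_eq_zero_add
  have h1 : ∑' j, 2 * (X : ℤ⟦X⟧) ^ ((i + 1) * (j + 1 + 1)) =
      X ^ (i + 1) * ∑' j, 2 * (X : ℤ⟦X⟧) ^ ((i + 1) * (j + 1)) := by
    rw [← hs.tsum_mul_left]
    exact tsum_congr fun j ↦ by ring
  rw [h1] at h0
  simp only [zero_add, mul_one] at h0
  linear_combination h0

/-- Gauss's identity `∏ (1 - X ^ k) / (1 + X ^ k) = 1 + 2 ∑ (-1) ^ k X ^ (k ^ 2)`, read as a formula
for the inverse of the generating function of overpartitions. -/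
theorem mk_overpartitionCount_mul :
    (PowerSeries.mk fun m ↦ (overpartitionCount m : ℤ)) * (1 + 2 * alternatingSquares) = 1 := by
  rw [mk_overpartitionCount]
  have hlim := ((Nat.Partition.hasProd_genFun (fun _ _ ↦ (2 : ℤ))).tendsto_prod_nat).mul_const
    (1 + 2 * alternatingSquares)
  simp only [smul_eq_C_mul, map_ofNat] at hlim
  set F : ℕ → ℤ⟦X⟧ := fun i ↦ 1 + ∑' j, 2 * (X : ℤ⟦X⟧) ^ ((i + 1) * (j + 1))
  refine tendsto_nhds_unique hlim ?_
  rw [WithPiTopology.tendsto_iff_coeff_tendsto]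
  intro d
  -- The partial product over `range n` agrees with the inverse of `1 + 2 * S` up to degree `n`.
  refine tendsto_atTop_of_eventually_const (i₀ := d) fun n hn ↦ ?_
  have hprod : (∏ i ∈ range n, F i) * ∏ i ∈ range n, (1 - (X : ℤ⟦X⟧) ^ (i + 1)) =
      ∏ i ∈ range n, (1 + X ^ (i + 1)) := by
    rw [← prod_mul_distrib]
    exact prod_congr rfl fun i _ ↦ one_add_tsum_mul_one_sub i
  have hgauss := pow_dvd_one_add_two_mul_sum_sq_mul_prod_sub (X : ℤ⟦X⟧) n
  have htrunc := X_pow_dvd_alternatingSquares_sub n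
  set a := ∑ s ∈ range n, (-1 : ℤ⟦X⟧) ^ (s + 1) * X ^ ((s + 1) ^ 2)
  set b := ∏ i ∈ range n, (1 + (X : ℤ⟦X⟧) ^ (i + 1))
  have hb : ¬ (X : ℤ⟦X⟧) ∣ b := by
    rw [X_dvd_iff, map_prod]
    simp
  have hdvd : (X : ℤ⟦X⟧) ^ (n + 1) ∣ b * ((∏ i ∈ range n, F i) * (1 + 2 * a) - 1) := by
    have := hgauss.mul_left (∏ i ∈ range n, F i)
    convert this using 1
    linear_combination hprod
  have hdvd' := X_prime.pow_dvd_of_dvd_mul_left _ hb hdvd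
  have htot : (X : ℤ⟦X⟧) ^ (n + 1) ∣
      (∏ i ∈ range n, F i) * (1 + 2 * alternatingSquares) - 1 := by
    have := dvd_add hdvd' (htrunc.mul_left (2 * ∏ i ∈ range n, F i))
    convert this using 1
    ring
  rw [X_pow_dvd_iff] at htot
  have := htot d (by omega)
  rwa [map_sub, sub_eq_zero] at this

end Topology

/-- Expanding `(1 + 2 S)⁻¹` to third order in `S = alternatingSquares`, the remainder being
divisible by `2 ^ 4`. -/
theorem overpartitionCount_modEq {m : ℕ} (hm : m ≠ 0) :
    (overpartitionCount m : ℤ) ≡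
      -2 * coeff m alternatingSquares + 4 * coeff m (alternatingSquares ^ 2) -
        8 * coeff m (alternatingSquares ^ 3) [ZMOD 16] := by
  have h := mk_overpartitionCount_mul
  set O : ℤ⟦X⟧ := PowerSeries.mk fun m ↦ (overpartitionCount m : ℤ) with hO
  set S := alternatingSquares
  have key : O = 1 + (C (-2 : ℤ) * S + C (4 : ℤ) * S ^ 2 - C (8 : ℤ) * S ^ 3) +
      C (16 : ℤ) * (S ^ 4 * O) := by
    simp only [map_neg, map_ofNat]
    linear_combination (1 - 2 * S + 4 * S ^ 2 - 8 * S ^ 3) * h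
  have hc := congrArg (coeff m) key
  simp only [map_add, map_sub, coeff_C_mul, coeff_one, if_neg hm, zero_add] at hc
  rw [hO, coeff_mk, ← hO] at hc
  rw [hc]
  exact (Int.modEq_iff_dvd.2 ⟨-coeff m (S ^ 4 * O), by ring⟩)

/-! ### Parity of the cubic term -/

theorem coeff_alternatingSquares_cast (m : ℕ) :
    ((coeff m alternatingSquares : ℤ) : ZMod 2) = if 0 < m ∧ IsSquare m then 1 else 0 := by
  rw [coeff_alternatingSquares]
  split_ifs
  · push_cast
    rw [show (-1 : ZMod 2) = 1 from rfl, one_pow]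
  · simp

/-- Squaring is additive modulo two, so `S ^ 2` has the coefficients of `S` at the doubled
exponents. -/
theorem coeff_alternatingSquares_sq_cast (j : ℕ) :
    ((coeff j (alternatingSquares ^ 2) : ℤ) : ZMod 2) =
      if Even j ∧ 0 < j / 2 ∧ IsSquare (j / 2) then 1 else 0 := by
  rw [sq, coeff_mul, Int.cast_sum]
  simp_rw [Int.cast_mul, coeff_alternatingSquares_cast]
  set t : ℕ → ZMod 2 := fun m ↦ if 0 < m ∧ IsSquare m then 1 else 0 with ht
  have htt (k : ℕ) : t k * t k = t k := by
    simp only [ht]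
    split_ifs <;> simp
  change ∑ p ∈ antidiagonal j, t p.1 * t p.2 = _
  -- Off-diagonal terms cancel in pairs.
  have hoff : ∑ p ∈ antidiagonal j with ¬ p.1 = p.2, t p.1 * t p.2 = 0 := by
    refine sum_involution (fun p _ ↦ p.swap) (fun p _ ↦ ?_) (fun p hp _ ↦ ?_) (fun p hp ↦ ?_)
      fun p _ ↦ p.swap_swap
    · rw [Prod.fst_swap, Prod.snd_swap, mul_comm (t p.2), CharTwo.add_self_eq_zero]
    · intro h
      exact (mem_filter.1 hp).2 (congrArg Prod.snd h)
    · rw [mem_filter, HasAntidiagonal.mem_antidiagonal] at hp ⊢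
      exact ⟨by rw [Prod.fst_swap, Prod.snd_swap, add_comm, hp.1], fun h ↦ hp.2 h.symm⟩
  rw [← sum_filter_add_sum_filter_not _ (fun p ↦ p.1 = p.2), hoff, add_zero]
  by_cases hj : Even j
  · have hdiag : {p ∈ antidiagonal j | p.1 = p.2} = {(j / 2, j / 2)} := by
      ext ⟨a, b⟩
      obtain ⟨r, rfl⟩ := hj
      simp only [mem_filter, HasAntidiagonal.mem_antidiagonal, mem_singleton, Prod.mk.injEq]
      omega
    rw [hdiag, sum_singleton, htt]
    simp only [ht, hj, true_and]
  · rw [if_neg fun h ↦ hj h.1]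
    refine sum_eq_zero fun p hp ↦ (hj ?_).elim
    rw [mem_filter, HasAntidiagonal.mem_antidiagonal] at hp
    exact ⟨p.1, by rw [← hp.1, ← hp.2]⟩

/-- The pairs `(a, c)` of positive integers with `a ^ 2 + 2 * c ^ 2 = m`. -/
def sqAddTwoSqPairs (m : ℕ) : Finset (ℕ × ℕ) :=
  (range (m + 1) ×ˢ range (m + 1)).filter
    fun p ↦ 0 < p.1 ∧ 0 < p.2 ∧ p.1 ^ 2 + 2 * p.2 ^ 2 = m

theorem mem_sqAddTwoSqPairs {m : ℕ} {p : ℕ × ℕ} :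
    p ∈ sqAddTwoSqPairs m ↔ 0 < p.1 ∧ 0 < p.2 ∧ p.1 ^ 2 + 2 * p.2 ^ 2 = m := by
  rw [sqAddTwoSqPairs, mem_filter, and_iff_right_iff_imp]
  rintro ⟨h1, h2, h3⟩
  rw [mem_product, mem_range, mem_range]
  constructor <;> nlinarith

theorem coeff_alternatingSquares_cube_cast (m : ℕ) :
    ((coeff m (alternatingSquares ^ 3) : ℤ) : ZMod 2) = ((sqAddTwoSqPairs m).card : ZMod 2) := by
  rw [pow_succ', coeff_mul, Int.cast_sum]
  simp_rw [Int.cast_mul, coeff_alternatingSquares_cast, coeff_alternatingSquares_sq_cast,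
    ite_zero_mul_ite_zero, one_mul]
  rw [sum_boole]
  congr 1
  refine card_nbij' (fun p ↦ (Nat.sqrt p.1, Nat.sqrt (p.2 / 2)))
    (fun p ↦ (p.1 ^ 2, 2 * p.2 ^ 2)) ?_ ?_ ?_ ?_
  · rintro ⟨i, j⟩ h
    simp only [coe_filter, HasAntidiagonal.mem_antidiagonal, Set.mem_ofPred_eq] at h
    obtain ⟨rfl, ⟨hi, a, rfl⟩, ⟨b, rfl⟩, hj, c, hc⟩ := h
    rw [mem_coe, mem_sqAddTwoSqPairs]
    dsimp only at *
    rw [hc, Nat.sqrt_eq, Nat.sqrt_eq]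
    refine ⟨Nat.pos_of_mul_pos_left hi, Nat.pos_of_mul_pos_left (hc ▸ hj), ?_⟩
    have : b = c * c := by omega
    rw [this]
    ring
  · rintro ⟨a, c⟩ h
    rw [mem_coe, mem_sqAddTwoSqPairs] at h
    obtain ⟨ha, hc, h⟩ := h
    simp only [coe_filter, HasAntidiagonal.mem_antidiagonal, Set.mem_ofPred_eq]
    rw [Nat.mul_div_cancel_left _ two_pos]
    exact ⟨h, ⟨pow_pos ha 2, IsSquare.sq a⟩, even_two_mul _, pow_pos hc 2, IsSquare.sq c⟩
  · rintro ⟨i, j⟩ h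
    simp only [coe_filter, HasAntidiagonal.mem_antidiagonal, Set.mem_ofPred_eq] at h
    obtain ⟨-, ⟨-, a, rfl⟩, ⟨b, rfl⟩, -, c, hc⟩ := h
    dsimp only
    rw [hc, Nat.sqrt_eq, Nat.sqrt_eq]
    ext
    · exact sq a
    · dsimp only
      rw [sq, ← hc]
      omega
  · rintro ⟨a, c⟩ -
    dsimp only
    rw [Nat.mul_div_cancel_left _ two_pos, Nat.sqrt_eq', Nat.sqrt_eq']

theorem coeff_alternatingSquares_eq_zero {m : ℕ} (h : ∀ a b : ℕ, a ^ 2 + b ^ 2 ≠ m) :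
    coeff m alternatingSquares = 0 := by
  rw [coeff_alternatingSquares, if_neg]
  rintro ⟨-, r, rfl⟩
  exact h r 0 (by ring)

theorem coeff_alternatingSquares_sq_eq_zero {m : ℕ} (h : ∀ a b : ℕ, a ^ 2 + b ^ 2 ≠ m) :
    coeff m (alternatingSquares ^ 2) = 0 := by
  rw [sq, coeff_mul]
  refine sum_eq_zero fun p hp ↦ ?_
  rw [HasAntidiagonal.mem_antidiagonal] at hp
  by_contra hne
  obtain ⟨h1, h2⟩ := mul_ne_zero_iff.1 hne
  rw [coeff_alternatingSquares, ne_eq, ite_eq_right_iff, Classical.not_imp] at h1 h2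
  obtain ⟨⟨-, a, ha⟩, -⟩ := h1
  obtain ⟨⟨-, b, hb⟩, -⟩ := h2
  exact h a b (by rw [← hp, ha, hb]; ring)

/-- If `m` is not a sum of two squares, only the cubic term of the expansion in
`overpartitionCount_modEq` can contribute. -/
theorem overpartitionCount_modEq_zero {m : ℕ} (h : ∀ a b : ℕ, a ^ 2 + b ^ 2 ≠ m)
    (he : Even (sqAddTwoSqPairs m).card) : overpartitionCount m ≡ 0 [MOD 16] := by
  have hm : m ≠ 0 := fun h0 ↦ h 0 0 (by rw [h0]; rfl)
  have h1 := overpartitionCount_modEq hm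
  rw [coeff_alternatingSquares_eq_zero h, coeff_alternatingSquares_sq_eq_zero h] at h1
  have h2 := coeff_alternatingSquares_cube_cast m
  rw [(ZMod.natCast_eq_zero_iff_even).2 he, ZMod.intCast_zmod_eq_zero_iff_dvd] at h2
  rw [← Int.natCast_modEq_iff]
  refine h1.trans (Int.modEq_zero_iff_dvd.2 ?_)
  obtain ⟨k, hk⟩ := h2
  exact ⟨-k, by rw [hk]; push_cast; ring⟩

/-! ### Representations by `a ^ 2 + b ^ 2` and `a ^ 2 + 2 * c ^ 2` -/

theorem sq_add_sq_ne_three_mul {k : ℕ} (hk : ¬ 3 ∣ k) (a b : ℕ) : a ^ 2 + b ^ 2 ≠ 3 * k := by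
  intro h
  have h3 : ∀ x y : ZMod 3, x ^ 2 + y ^ 2 = 0 → x = 0 ∧ y = 0 := by decide
  have hab := h3 a b (by
    have := congrArg (Nat.cast (R := ZMod 3)) h
    push_cast at this
    rw [this, show (3 : ZMod 3) = 0 from rfl, zero_mul])
  rw [ZMod.natCast_eq_zero_iff, ZMod.natCast_eq_zero_iff] at hab
  obtain ⟨⟨u, rfl⟩, ⟨v, rfl⟩⟩ := hab
  exact hk ⟨u ^ 2 + v ^ 2, by linarith⟩

theorem sq_add_sq_ne_seven_mul {k : ℕ} (hk : ¬ 7 ∣ k) (a b : ℕ) : a ^ 2 + b ^ 2 ≠ 7 * k := by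
  intro h
  have h7 : ∀ x y : ZMod 7, x ^ 2 + y ^ 2 = 0 → x = 0 ∧ y = 0 := by decide
  have hab := h7 a b (by
    have := congrArg (Nat.cast (R := ZMod 7)) h
    push_cast at this
    rw [this, show (7 : ZMod 7) = 0 from rfl, zero_mul])
  rw [ZMod.natCast_eq_zero_iff, ZMod.natCast_eq_zero_iff] at hab
  obtain ⟨⟨u, rfl⟩, ⟨v, rfl⟩⟩ := hab
  exact hk ⟨u ^ 2 + v ^ 2, by linarith⟩

theorem sq_add_two_mul_sq_ne_seven_mul {k : ℕ} (hk : ¬ 7 ∣ k) (a b : ℕ) :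
    a ^ 2 + 2 * b ^ 2 ≠ 7 * k := by
  intro h
  have h7 : ∀ x y : ZMod 7, x ^ 2 + 2 * y ^ 2 = 0 → x = 0 ∧ y = 0 := by decide
  have hab := h7 a b (by
    have := congrArg (Nat.cast (R := ZMod 7)) h
    push_cast at this
    rw [this, show (7 : ZMod 7) = 0 from rfl, zero_mul])
  rw [ZMod.natCast_eq_zero_iff, ZMod.natCast_eq_zero_iff] at hab
  obtain ⟨⟨u, rfl⟩, ⟨v, rfl⟩⟩ := hab
  exact hk ⟨u ^ 2 + 2 * v ^ 2, by linarith⟩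

/-- For `x ^ 2 + 2 * y ^ 2 = 3 * M`, the pair of absolute values of the coordinates of
`w * conj (w⁻¹ * (x + y √-2))`, where `w = 1 ± √-2` is the divisor of norm `3` of `x + y √-2`. -/
def reflectPair (p : ℕ × ℕ) : ℕ × ℕ :=
  if p.1 % 3 = p.2 % 3 then
    (((4 * p.2 - p.1 : ℤ) / 3).natAbs, (2 * p.1 + p.2) / 3)
  else ((p.1 + 4 * p.2) / 3, ((2 * p.1 - p.2 : ℤ) / 3).natAbs)

theorem mod_three_of_sq_add_two_mul_sq {M x y : ℕ} (h3 : ¬ 3 ∣ M)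
    (h : x ^ 2 + 2 * y ^ 2 = 3 * M) : ¬ 3 ∣ x ∧ (x % 3 = y % 3 ∨ 3 ∣ x + y) := by
  have hz : ∀ a b : ZMod 3, a ^ 2 + 2 * b ^ 2 = 0 → (a = 0 → b = 0) ∧ (a = b ∨ a + b = 0) := by
    decide
  have hxy := hz x y (by
    have := congrArg (Nat.cast (R := ZMod 3)) h
    push_cast at this
    rw [this, show (3 : ZMod 3) = 0 from rfl, zero_mul])
  rw [ZMod.natCast_eq_zero_iff, ZMod.natCast_eq_zero_iff, ZMod.natCast_eq_natCast_iff',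
    ← Nat.cast_add, ZMod.natCast_eq_zero_iff] at hxy
  refine ⟨fun hx ↦ ?_, hxy.2⟩
  obtain ⟨u, rfl⟩ := hx
  obtain ⟨v, rfl⟩ := hxy.1 (dvd_mul_right 3 u)
  exact h3 ⟨u ^ 2 + 2 * v ^ 2, by linarith⟩

/-- On the positive solutions of `x ^ 2 + 2 * y ^ 2 = 3 * M`, `reflectPair` is an involution. A zero
coordinate in the image, or a fixed point, would force `M` to be even, divisible by `3`, or a
square. -/
theorem reflectPair_spec {M x y : ℕ} (hodd : ¬ 2 ∣ M) (h3 : ¬ 3 ∣ M) (hsq : ¬ IsSquare M)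
    (hx : 0 < x) (hy : 0 < y) (h : x ^ 2 + 2 * y ^ 2 = 3 * M) :
    reflectPair (x, y) ∈ sqAddTwoSqPairs (3 * M) ∧ reflectPair (x, y) ≠ (x, y) ∧
      reflectPair (reflectPair (x, y)) = (x, y) := by
  obtain ⟨hx3, hxy⟩ := mod_three_of_sq_add_two_mul_sq h3 h
  by_cases hmod : x % 3 = y % 3
  · obtain ⟨u, v, hu, hv, huv⟩ : ∃ u v : ℕ, reflectPair (x, y) = (u, v) ∧
        3 * v = 2 * x + y ∧ (3 * u + x = 4 * y ∨ 3 * u + 4 * y = x) := by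
      refine ⟨_, _, if_pos hmod, ?_, ?_⟩
      all_goals dsimp only; omega
    have hM : u ^ 2 + 2 * v ^ 2 = 3 * M := by
      zify at *
      rcases huv with huv | huv <;> nlinarith
    have hu3 := (mod_three_of_sq_add_two_mul_sq h3 hM).1
    have hu0 : 0 < u := by
      rcases Nat.eq_zero_or_pos u with rfl | hu0
      · obtain rfl : x = 4 * y := by omega
        exact (hodd ⟨3 * y ^ 2, by linarith⟩).elim
      · exact hu0
    have hback : reflectPair (u, v) = (x, y) := by
      simp only [reflectPair]
      split_ifs with hc <;> ext <;> dsimp only <;> omega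
    rw [hu]
    refine ⟨mem_sqAddTwoSqPairs.2 ⟨hu0, by dsimp only; omega, hM⟩, ?_, hback⟩
    rw [ne_eq, Prod.mk.injEq]
    rintro ⟨rfl, rfl⟩
    have : v = u := by omega
    subst this
    exact hsq ⟨v, by linarith⟩
  · obtain ⟨u, v, hu, hv, huv⟩ : ∃ u v : ℕ, reflectPair (x, y) = (u, v) ∧
        3 * u = x + 4 * y ∧ (3 * v + y = 2 * x ∨ 3 * v + 2 * x = y) := by
      refine ⟨_, _, if_neg hmod, ?_, ?_⟩
      all_goals dsimp only; omega
    have hM : u ^ 2 + 2 * v ^ 2 = 3 * M := by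
      zify at *
      rcases huv with huv | huv <;> nlinarith
    have hu3 := (mod_three_of_sq_add_two_mul_sq h3 hM).1
    have hv0 : 0 < v := by
      rcases Nat.eq_zero_or_pos v with rfl | hv0
      · obtain rfl : y = 2 * x := by omega
        exact (h3 ⟨x ^ 2, by linarith⟩).elim
      · exact hv0
    have hback : reflectPair (u, v) = (x, y) := by
      simp only [reflectPair]
      split_ifs with hc <;> ext <;> dsimp only <;> omega
    rw [hu]
    refine ⟨mem_sqAddTwoSqPairs.2 ⟨by dsimp only; omega, hv0, hM⟩, ?_, hback⟩
    rw [ne_eq, Prod.mk.injEq]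
    rintro ⟨rfl, rfl⟩
    obtain rfl : u = 2 * v := by omega
    exact hodd ⟨v ^ 2, by linarith⟩

theorem even_card_sqAddTwoSqPairs_three_mul {M : ℕ} (hodd : ¬ 2 ∣ M) (h3 : ¬ 3 ∣ M)
    (hsq : ¬ IsSquare M) : Even (sqAddTwoSqPairs (3 * M)).card := by
  rw [← ZMod.natCast_eq_zero_iff_even, card_eq_sum_ones, Nat.cast_sum]
  have hspec {p : ℕ × ℕ} (hp : p ∈ sqAddTwoSqPairs (3 * M)) :=
    have h := mem_sqAddTwoSqPairs.1 hp
    reflectPair_spec hodd h3 hsq h.1 h.2.1 h.2.2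
  exact sum_involution (fun p _ ↦ reflectPair p) (fun _ _ ↦ by decide)
    (fun _ hp _ ↦ (hspec hp).2.1) (fun _ hp ↦ (hspec hp).1) fun _ hp ↦ (hspec hp).2.2

/-- If `a ^ 2 + 2 * c ^ 2 = 2 * k` then `a` is even, and `(c, a / 2)` is a solution for `k`. -/
theorem card_sqAddTwoSqPairs_two_mul (k : ℕ) :
    (sqAddTwoSqPairs (2 * k)).card = (sqAddTwoSqPairs k).card := by
  refine card_nbij' (fun p ↦ (p.2, p.1 / 2)) (fun p ↦ (2 * p.2, p.1)) ?_ ?_ ?_ ?_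
  · rintro ⟨a, c⟩ h
    rw [mem_coe, mem_sqAddTwoSqPairs] at h ⊢
    obtain ⟨ha, hc, h⟩ := h
    dsimp only at *
    have hev : Even a := (Nat.even_pow' two_ne_zero).1 ⟨k - c ^ 2, by omega⟩
    obtain ⟨b, rfl⟩ := hev
    rw [show (b + b) / 2 = b by omega]
    refine ⟨hc, by omega, by linarith⟩
  · rintro ⟨a, c⟩ h
    rw [mem_coe, mem_sqAddTwoSqPairs] at h ⊢
    obtain ⟨ha, hc, h⟩ := h
    dsimp only at *
    refine ⟨by omega, ha, by linarith⟩
  · rintro ⟨a, c⟩ h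
    rw [mem_coe, mem_sqAddTwoSqPairs] at h
    obtain ⟨ha, hc, h⟩ := h
    dsimp only at *
    have hev : Even a := (Nat.even_pow' two_ne_zero).1 ⟨k - c ^ 2, by omega⟩
    rw [Nat.mul_div_cancel' hev.two_dvd]
  · rintro ⟨a, c⟩ -
    dsimp only
    rw [Nat.mul_div_cancel_left _ two_pos]

theorem overpartitionCount_six_mul_modEq_zero {M : ℕ} (hodd : ¬ 2 ∣ M) (h3 : ¬ 3 ∣ M)
    (hsq : ¬ IsSquare M) : overpartitionCount (6 * M) ≡ 0 [MOD 16] := by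
  refine overpartitionCount_modEq_zero ?_ ?_
  · rw [show 6 * M = 3 * (2 * M) by ring]
    exact sq_add_sq_ne_three_mul (by omega)
  · rw [show 6 * M = 2 * (3 * M) by ring, card_sqAddTwoSqPairs_two_mul]
    exact even_card_sqAddTwoSqPairs_three_mul hodd h3 hsq

theorem not_isSquare_of_zmod {q M : ℕ} (h : ¬ IsSquare (M : ZMod q)) : ¬ IsSquare M :=
  fun hM ↦ h (hM.map (Nat.castRingHom (ZMod q)))

theorem theorem1p3 (A B : ℕ)
    (hAB : (A, B) ∈ ({(36, 30), (72, 42), (196, 70), (252, 114)} : Set (ℕ × ℕ))) (n : ℕ) :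
    overpartitionCount (A * n + B) ≡ 0 [MOD 16] := by
  simp only [Set.mem_insert_iff, Set.mem_singleton_iff, Prod.mk.injEq] at hAB
  rcases hAB with ⟨rfl, rfl⟩ | ⟨rfl, rfl⟩ | ⟨rfl, rfl⟩ | ⟨rfl, rfl⟩
  · rw [show 36 * n + 30 = 6 * (6 * n + 5) by ring]
    refine overpartitionCount_six_mul_modEq_zero (by omega) (by omega)
      (not_isSquare_of_zmod (q := 3) ?_)
    push_cast
    rw [show (6 : ZMod 3) = 0 from rfl, zero_mul, zero_add]
    decide
  · rw [show 72 * n + 42 = 6 * (12 * n + 7) by ring]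
    refine overpartitionCount_six_mul_modEq_zero (by omega) (by omega)
      (not_isSquare_of_zmod (q := 4) ?_)
    push_cast
    rw [show (12 : ZMod 4) = 0 from rfl, zero_mul, zero_add]
    decide
  · rw [show 196 * n + 70 = 7 * (28 * n + 10) by ring]
    refine overpartitionCount_modEq_zero (sq_add_sq_ne_seven_mul (by omega)) ?_
    rw [show sqAddTwoSqPairs (7 * (28 * n + 10)) = ∅ from eq_empty_of_forall_notMem fun p hp ↦
      sq_add_two_mul_sq_ne_seven_mul (by omega) _ _ (mem_sqAddTwoSqPairs.1 hp).2.2]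
    simp
  · rw [show 252 * n + 114 = 6 * (42 * n + 19) by ring]
    refine overpartitionCount_six_mul_modEq_zero (by omega) (by omega)
      (not_isSquare_of_zmod (q := 7) ?_)
    push_cast
    rw [show (42 : ZMod 7) = 0 from rfl, zero_mul, zero_add]
    decide
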